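/- Let $K$ be a field of prime characteristic $p$, and let $A_1$ be the first Weyl algebra over $K$, i.e. the free unital associative $K$-algebra on two letters $x,y$ modulo the relation $xy-yx=1$. Let $k=(k_0,k_p,k_{2p},\ldots)$ be a sequence of elements of $K$ of which only finitely many are nonzero, and let $\alpha_k$ be the unital $K$-algebra endomorphism of $A_1$ with $\alpha_k(x)=x$ and $\alpha_k(y)=k_0+y+k_py^p+k_{2p}y^{2p}+\cdots$. The first hom-associative Weyl algebra $A_1^k$ is the $K$-vector space $A_1$ with the product $a*b:=\alpha_k(ab)$ and the twisting map $\alpha_k$. An endomorphism of $A_1^k$ is a $K$-linear map $f\colon A_1\to A_1$ such that $f(a*b)=f(a)*f(b)$ for all $a,b\in A_1$ and $f\circ\alpha_k=\alpha_k\circ f$. Then every nonzero endomorphism of $A_1^k$ is injective. -/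

import Mathlib

open Polynomial

/-- A hom-associative algebra structure on an `R`-module `M`: a bilinear product and a linear
twisting map `α` with `α(a) · (b · c) = (a · b) · α(c)`. -/
structure HomAssocAlgebra (R M : Type*) [CommRing R] [AddCommGroup M] [Module R M] where
  mul : M →ₗ[R] M →ₗ[R] M
  twist : M →ₗ[R] M
  hom_assoc : ∀ a b c : M, mul (twist a) (mul b c) = mul (mul a b) (twist c)

/-- A homomorphism of hom-associative algebras: a linear, multiplicative map which intertwines
the twisting maps. -/
structure HomAssocAlgebra.Hom {R M N : Type*} [CommRing R] [AddCommGroup M] [Module R M]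
    [AddCommGroup N] [Module R N] (A : HomAssocAlgebra R M) (B : HomAssocAlgebra R N) where
  toLinearMap : M →ₗ[R] N
  map_mul : ∀ a b : M, toLinearMap (A.mul a b) = B.mul (toLinearMap a) (toLinearMap b)
  map_twist : toLinearMap ∘ₗ A.twist = B.twist ∘ₗ toLinearMap

/-- Endomorphisms of a hom-associative algebra. -/
abbrev HomAssocAlgebra.End {R M : Type*} [CommRing R] [AddCommGroup M] [Module R M]
    (A : HomAssocAlgebra R M) := HomAssocAlgebra.Hom A A

/-- The Yau twist of a (not necessarily unital) associative algebra `A` by an endomorphism `α`: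
the product is `a * b = α(a · b)` and the twisting map is `α`. -/
def yauTwist {R A : Type*} [CommRing R] [NonUnitalRing A] [Module R A] [IsScalarTower R A A]
    [SMulCommClass R A A] (α : A →ₙₐ[R] A) : HomAssocAlgebra R A where
  mul := (LinearMap.mul R A).compr₂ (α : A →ₗ[R] A)
  twist := (α : A →ₗ[R] A)
  hom_assoc a b c := by simp [mul_assoc]

/-- The two letters generating the first Weyl algebra. -/
inductive WeylLetter : Type
  | x
  | y

/-- The commutation relation `x y - y x = 1`. -/
inductive WeylRel (K : Type*) [Field K] :
    FreeAlgebra K WeylLetter → FreeAlgebra K WeylLetter → Prop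
  | comm : WeylRel K
      (FreeAlgebra.ι K WeylLetter.x * FreeAlgebra.ι K WeylLetter.y -
        FreeAlgebra.ι K WeylLetter.y * FreeAlgebra.ι K WeylLetter.x) 1

/-- The first Weyl algebra over `K`: the free unital associative algebra on two letters `x`, `y`
modulo the relation `x y - y x = 1`. -/
abbrev WeylAlgebra (K : Type*) [Field K] := RingQuot (WeylRel K)

namespace WeylAlgebra

/-- The generator `x` of the first Weyl algebra. -/
noncomputable def x (K : Type*) [Field K] : WeylAlgebra K :=
  RingQuot.mkAlgHom K (WeylRel K) (FreeAlgebra.ι K WeylLetter.x)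

/-- The generator `y` of the first Weyl algebra. -/
noncomputable def y (K : Type*) [Field K] : WeylAlgebra K :=
  RingQuot.mkAlgHom K (WeylRel K) (FreeAlgebra.ι K WeylLetter.y)

theorem x_mul_y_sub (K : Type*) [Field K] : x K * y K - y K * x K = 1 := by
  have h := RingQuot.mkAlgHom_rel K (WeylRel.comm (K := K))
  simpa [x, y] using h

/-- `x q(y) = q(y) x + q'(y)`. -/
theorem x_mul_aeval {K : Type*} [Field K] (q : K[X]) :
    x K * aeval (y K) q = aeval (y K) q * x K + aeval (y K) (derivative q) := by
  have hxy : x K * y K = y K * x K + 1 := by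
    rw [← x_mul_y_sub K]; abel
  induction q using Polynomial.induction_on' with
  | add p q hp hq => simp only [map_add, mul_add, add_mul, hp, hq]; abel
  | monomial n a =>
    rw [← C_mul_X_pow_eq_monomial]
    induction n with
    | zero => simp [Algebra.commutes]
    | succ n ih =>
      have e : (C a * X ^ (n + 1) : K[X]) = C a * X ^ n * X := by rw [pow_succ, mul_assoc]
      rw [e]
      generalize (C a * X ^ n : K[X]) = r at ih
      simp only [map_mul, aeval_X, derivative_mul, derivative_X, mul_one, map_add]
      rw [← mul_assoc, ih, add_mul, mul_assoc _ (x K) (y K), hxy]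
      noncomm_ring

/-- The polynomial `k₀ + y + k_p y^p + k_{2p} y^{2p} + ⋯`. The finitely supported sequence `k`
has `i`-th entry `k_{ip}`. -/
noncomputable def twistPoly {K : Type*} [Field K] (p : ℕ) (k : ℕ →₀ K) : K[X] :=
  X + k.sum fun i c => C c * X ^ (i * p)

theorem derivative_twistPoly {K : Type*} [Field K] (p : ℕ) [CharP K p] (k : ℕ →₀ K) :
    derivative (twistPoly p k) = 1 := by
  simp [twistPoly, Finsupp.sum, derivative_X_pow]

/-- The unital algebra endomorphism `α_k` of the first Weyl algebra over a field of
characteristic `p`, with `α_k(x) = x` and `α_k(y) = k₀ + y + k_p y^p + k_{2p} y^{2p} + ⋯`. -/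
noncomputable def twist {K : Type*} [Field K] (p : ℕ) [CharP K p] (k : ℕ →₀ K) :
    WeylAlgebra K →ₐ[K] WeylAlgebra K :=
  RingQuot.liftAlgHom K
    ⟨FreeAlgebra.lift K fun
        | WeylLetter.x => x K
        | WeylLetter.y => aeval (y K) (twistPoly p k), by
      rintro _ _ ⟨⟩
      simp [x_mul_aeval, derivative_twistPoly]⟩

theorem twist_x {K : Type*} [Field K] (p : ℕ) [CharP K p] (k : ℕ →₀ K) :
    twist p k (x K) = x K := by
  simp [twist, x]

theorem twist_y {K : Type*} [Field K] (p : ℕ) [CharP K p] (k : ℕ →₀ K) :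
    twist p k (y K) = aeval (y K) (twistPoly p k) := by
  simp [twist, y]

/-- `α_k` is the homogeneous extension to `A₁ = K[y][x; id, d/dy]` of the endomorphism
`q(y) ↦ q(k₀ + y + k_p y^p + ⋯)` of `K[y]`. -/
theorem twist_aeval_mul_x_pow {K : Type*} [Field K] (p : ℕ) [CharP K p] (k : ℕ →₀ K)
    (q : K[X]) (n : ℕ) :
    twist p k (aeval (y K) q * x K ^ n) = aeval (y K) (q.comp (twistPoly p k)) * x K ^ n := by
  rw [map_mul, map_pow, twist_x, ← aeval_algHom_apply, twist_y, aeval_comp]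

end WeylAlgebra

/-- The first hom-associative Weyl algebra `A₁^k` over a field of characteristic `p`: the Yau
twist of the first Weyl algebra by `α_k`. -/
noncomputable def homWeylAlgebra {K : Type*} [Field K] (p : ℕ) [CharP K p] (k : ℕ →₀ K) :
    HomAssocAlgebra K (WeylAlgebra K) :=
  yauTwist (WeylAlgebra.twist p k : WeylAlgebra K →ₙₐ[K] WeylAlgebra K)

/-! The twist `α_k` is injective, so it can be cancelled: a nonzero endomorphism of `A₁^k` is a
unital algebra endomorphism `F` of `A₁`. The content is therefore `algHom_injective`. In
characteristic `p` the algebra `A₁` is not simple, so growth replaces simplicity.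

Suppose `F w = 0` with `w ≠ 0`. The left ideal generated by `w` fills up all but a linearly growing
part of the boxes of monomials, so the image of `F` grows at most linearly (`finrank_map_box_le`).
Two elements of the image with non-parallel lexicographic degrees would give quadratic growth
(`ldeg_parallel`). Hence all degrees lie on one ray, and the total degree of the leading monomial is
a degree function on the image with one-dimensional leaves.

By `mul_comm_of_degree_leaf`, a central element of positive degree would make the image commutative,
contradicting `[F x, F y] = 1`. But `F x ^ p` and `F y ^ p` are central in the image, so `F x` and
`F y` have degree zero. They are then scalars, and the same relation fails. -/

/-! ### A commutativity criterion -/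

/-- A ring without zero divisors, with a degree function into `ℕ` whose leaves are one-dimensional
and with a central element of positive degree, is commutative. -/
theorem mul_comm_of_degree_leaf {K B : Type*} [Field K] [Ring B] [NoZeroDivisors B] [Algebra K B]
    (v : B → ℕ) (hzero : v 0 = 0) (hmul : ∀ a b, a ≠ 0 → b ≠ 0 → v (a * b) = v a + v b)
    (hsub : ∀ a b, v (a - b) ≤ max (v a) (v b))
    (hleaf : ∀ a b, a ≠ 0 → b ≠ 0 → v a = v b → ∃ c : K, a - c • b = 0 ∨ v (a - c • b) < v a)
    (z : B) (hz : ∀ b, Commute z b) (hvz : 0 < v z) (a b : B) : a * b = b * a := by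
  have hz0 : z ≠ 0 := by rintro rfl; omega
  have : Nontrivial B := ⟨z, 0, hz0⟩
  have : NeZero (v z) := ⟨hvz.ne'⟩
  have hmul_le : ∀ a b, v (a * b) ≤ v a + v b := by
    intro a b
    by_cases ha : a = 0
    · simp [ha, hzero]
    by_cases hb : b = 0
    · simp [hb, hzero]
    exact (hmul a b ha hb).le
  have hone : v 1 = 0 := by
    have := hmul 1 1 one_ne_zero one_ne_zero
    rw [mul_one] at this; omega
  have hpow : ∀ b, b ≠ 0 → ∀ n : ℕ, v (b ^ n) = n * v b := by
    intro b hb n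
    induction n with
    | zero => simp [hone]
    | succ n ih => rw [pow_succ, hmul _ _ (pow_ne_zero _ hb) hb, ih]; ring
  -- The degrees modulo `v z` form a subgroup of a cyclic group; `w` is chosen so that its degree
  -- generates it.
  let H : AddSubgroup (ZMod (v z)) :=
    { carrier := {n | ∃ b : B, b ≠ 0 ∧ (v b : ZMod (v z)) = n}
      zero_mem' := ⟨1, one_ne_zero, by simp [hone]⟩
      add_mem' := by
        rintro _ _ ⟨b, hb, rfl⟩ ⟨c, hc, rfl⟩
        exact ⟨b * c, mul_ne_zero hb hc, by rw [hmul b c hb hc]; push_cast; rfl⟩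
      neg_mem' := by
        rintro _ ⟨b, hb, rfl⟩
        refine ⟨b ^ (v z - 1), pow_ne_zero _ hb, ?_⟩
        rw [hpow b hb]
        push_cast [Nat.cast_sub (Nat.one_le_iff_ne_zero.2 hvz.ne')]
        simp }
  obtain ⟨⟨_, w, hw, rfl⟩, hgen⟩ := IsAddCyclic.exists_generator (α := H)
  -- Modulo the polynomials in `w` and `z` every element has bounded degree.
  have hred : ∀ n b, v b ≤ n → ∃ c ∈ Algebra.adjoin K {w, z}, v (b - c) ≤ v z * v w := by
    intro n
    induction n using Nat.strong_induction_on with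
    | _ n ih =>
    intro b hbn
    by_cases hbM : v b ≤ v z * v w
    · exact ⟨0, zero_mem _, by simpa using hbM⟩
    have hb : b ≠ 0 := by rintro rfl; omega
    obtain ⟨i, hi⟩ := (mem_multiples_iff_mem_zmultiples.2
      (hgen ⟨(v b : ZMod (v z)), b, hb, rfl⟩) : _)
    have hi : ((i * v w : ℕ) : ZMod (v z)) = v b := by
      have := congrArg Subtype.val hi
      simpa using this
    -- Reducing the exponent keeps the degree of the power of `w` at most `v z * v w < v b`, so a
    -- power of `z` can make up the difference.
    have hi' : ((i % v z * v w : ℕ) : ZMod (v z)) = v b := by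
      rw [← hi]; push_cast; simp
    have hlt : i % v z * v w ≤ v b :=
      (Nat.mul_le_mul_right _ (Nat.mod_lt _ hvz).le).trans (by omega)
    obtain ⟨j, hj⟩ := (Nat.modEq_iff_dvd' hlt).1 ((ZMod.natCast_eq_natCast_iff _ _ _).1 hi')
    set t := w ^ (i % v z) * z ^ j
    have ht0 : t ≠ 0 := mul_ne_zero (pow_ne_zero _ hw) (pow_ne_zero _ hz0)
    have htmem : t ∈ Algebra.adjoin K {w, z} :=
      mul_mem (pow_mem (Algebra.subset_adjoin (by simp)) _)
        (pow_mem (Algebra.subset_adjoin (by simp)) _)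
    have hvt : v b = v t := by
      rw [hmul _ _ (pow_ne_zero _ hw) (pow_ne_zero _ hz0), hpow w hw, hpow z hz0,
        mul_comm j]
      omega
    obtain ⟨c, hc | hc⟩ := hleaf b t hb ht0 hvt
    · exact ⟨c • t, Subalgebra.smul_mem _ htmem c, by simp [hc, hzero]⟩
    · obtain ⟨d, hd, hd'⟩ := ih _ (by omega) (b - c • t) le_rfl
      exact ⟨c • t + d, add_mem (Subalgebra.smul_mem _ htmem c) hd, by rwa [← sub_sub]⟩
  have hadj : ∀ d, Commute w d → ∀ c ∈ Algebra.adjoin K {w, z}, Commute c d := by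
    intro d hd c hc
    refine (Algebra.commute_of_mem_adjoin_of_forall_mem_commute hc ?_).symm
    rintro _ (rfl | rfl)
    · exact hd.symm
    · exact (hz d).symm
  -- An element commuting with `w` is central.
  have hcentral : ∀ d, Commute w d → ∀ b, Commute d b := by
    intro d hd b
    by_contra hdb
    have hne : d * b - b * d ≠ 0 := fun h => hdb (sub_eq_zero.1 h)
    -- Modulo elements commuting with `d`, `z ^ n * b` is the bounded remainder `r`. So `z ^ n * [d,
    -- b] = [d, r]` has degree at most `v d + v z * v w`, which this `n` exceeds.
    set n := v d + v z * v w + 1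
    obtain ⟨c, hc, hc'⟩ := hred _ (z ^ n * b) le_rfl
    set r := z ^ n * b - c
    have hdc : Commute c d := hadj d hd c hc
    have hzn : Commute (z ^ n) d := (hz d).pow_left n
    have heq : z ^ n * (d * b - b * d) = d * r - r * d := by
      simp only [r, mul_sub, sub_mul, hdc.eq]
      rw [← mul_assoc, hzn.eq]
      noncomm_ring
    have h1 : v (d * r - r * d) ≤ v d + v z * v w :=
      (hsub _ _).trans (max_le ((hmul_le _ _).trans (by omega)) ((hmul_le _ _).trans (by omega)))
    rw [← heq, hmul _ _ (pow_ne_zero _ hz0) hne, hpow z hz0] at h1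
    have := Nat.le_mul_of_pos_right n hvz
    omega
  -- `w` commutes with itself, hence is central; so every `a` commutes with `w` and is central too.
  exact hcentral a (hcentral w (Commute.refl w) a) b

theorem finrank_map_add_finrank_le {K V W : Type*} [Field K] [AddCommGroup V] [Module K V]
    [AddCommGroup W] [Module K W] (f : V →ₗ[K] W) {S T : Submodule K V} [FiniteDimensional K S]
    (hTS : T ≤ S) (hT : T ≤ LinearMap.ker f) :
    Module.finrank K (S.map f) + Module.finrank K T ≤ Module.finrank K S := by
  have h := (f.domRestrict S).finrank_range_add_finrank_ker
  rw [LinearMap.range_domRestrict] at h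
  rw [← h, ← (Submodule.comapSubtypeEquivOfLe hTS).finrank_eq]
  have hle : T.comap S.subtype ≤ LinearMap.ker (f.domRestrict S) := fun a ha => hT ha
  exact Nat.add_le_add_left (Submodule.finrank_mono hle) _

/-! ### Normal ordering and a faithful representation -/

namespace WeylAlgebra

variable {K : Type*} [Field K]

variable (K) in
/-- `x` acts on `K[t][y]` as `t + d/dy`. -/
noncomputable def actX : Module.End K K[X][X] :=
  LinearMap.mulLeft K (C X) + (derivative : K[X][X] →ₗ[K[X]] K[X][X]).restrictScalars K

variable (K) in
/-- `y` acts on `K[t][y]` by multiplication. -/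
noncomputable def actY : Module.End K K[X][X] :=
  LinearMap.mulLeft K X

@[simp] theorem actX_apply (m : K[X][X]) : actX K m = C X * m + derivative m := rfl

@[simp] theorem actY_apply (m : K[X][X]) : actY K m = X * m := rfl

variable (K) in
/-- The faithful representation of the Weyl algebra on `K[t][y]`. -/
noncomputable def rep : WeylAlgebra K →ₐ[K] Module.End K K[X][X] :=
  RingQuot.liftAlgHom K
    ⟨FreeAlgebra.lift K fun
        | WeylLetter.x => actX K
        | WeylLetter.y => actY K, by
      rintro _ _ ⟨⟩
      ext1 m
      simp [derivative_mul]
      ring⟩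

@[simp] theorem rep_x : rep K (x K) = actX K := by simp [rep, x]

@[simp] theorem rep_y : rep K (y K) = actY K := by simp [rep, y]

theorem induction_on {P : WeylAlgebra K → Prop} (hx : P (x K)) (hy : P (y K))
    (hC : ∀ c : K, P (algebraMap K _ c)) (hadd : ∀ a b, P a → P b → P (a + b))
    (hmul : ∀ a b, P a → P b → P (a * b)) (a : WeylAlgebra K) : P a := by
  obtain ⟨a, rfl⟩ := RingQuot.mkAlgHom_surjective K (WeylRel K) a
  induction a using FreeAlgebra.induction with
  | grade0 c => simpa using hC c
  | grade1 l => cases l <;> assumption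
  | mul a b ha hb => simpa using hmul _ _ ha hb
  | add a b ha hb => simpa using hadd _ _ ha hb

variable (K) in
/-- Normal ordering: `∑ rᵢ(t) yⁱ ↦ ∑ yⁱ rᵢ(x)`. -/
noncomputable def ofSymbol : K[X][X] →ₗ[K] WeylAlgebra K :=
  lsum fun i => LinearMap.mulLeft K (y K ^ i) ∘ₗ (aeval (x K)).toLinearMap

@[simp] theorem ofSymbol_monomial (i : ℕ) (r : K[X]) :
    ofSymbol K (monomial i r) = y K ^ i * aeval (x K) r := by
  simp [ofSymbol, lsum_apply, sum_monomial_index]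

@[simp] theorem ofSymbol_one : ofSymbol K 1 = 1 := by
  have h := ofSymbol_monomial (K := K) 0 1
  simpa using h

theorem ofSymbol_actY (m : K[X][X]) : ofSymbol K (actY K m) = y K * ofSymbol K m := by
  induction m using Polynomial.induction_on' with
  | add p q hp hq => simp only [map_add, mul_add, hp, hq]
  | monomial i r => simp [X_mul_monomial, pow_succ', mul_assoc]

theorem ofSymbol_actX (m : K[X][X]) : ofSymbol K (actX K m) = x K * ofSymbol K m := by
  induction m using Polynomial.induction_on' with
  | add p q hp hq => simp only [map_add, mul_add, hp, hq]
  | monomial i r =>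
    have h := x_mul_aeval (K := K) (X ^ i)
    simp only [map_pow, aeval_X, derivative_X_pow, map_mul, map_natCast] at h
    rw [ofSymbol_monomial, ← mul_assoc, h, actX_apply, C_mul_monomial, derivative_monomial,
      map_add, ofSymbol_monomial, ofSymbol_monomial, add_mul, mul_assoc]
    simp only [map_mul, aeval_X, map_natCast]
    congr 1
    rw [(Nat.cast_commute i (y K ^ (i - 1))).eq, mul_assoc, (Nat.cast_commute i _).eq]

/-- Normal ordering is a map of left modules onto the regular one; as it sends `1` to `1`, it is
inverted by acting on `1`. -/
theorem ofSymbol_rep (a : WeylAlgebra K) (m : K[X][X]) :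
    ofSymbol K (rep K a m) = a * ofSymbol K m := by
  induction a using induction_on generalizing m with
  | hx => rw [rep_x, ofSymbol_actX]
  | hy => rw [rep_y, ofSymbol_actY]
  | hC c =>
    rw [AlgHom.commutes, Module.algebraMap_end_apply, map_smul, Algebra.smul_def]
  | hadd a b ha hb => simp [ha, hb, add_mul]
  | hmul a b ha hb => simp [ha, hb, mul_assoc]

/-! ### Degree in `y` and leading coefficients -/

theorem natDegree_rep_aeval_x_le (r : K[X]) {e : ℕ} {m : K[X][X]} (hm : m.natDegree ≤ e) :
    (rep K (aeval (x K) r) m).natDegree ≤ e ∧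
      (rep K (aeval (x K) r) m).coeff e = r * m.coeff e := by
  induction r using Polynomial.induction_on' generalizing m with
  | add p q hp hq =>
    simp only [map_add, LinearMap.add_apply, coeff_add, add_mul]
    exact ⟨natDegree_add_le_of_degree_le (hp hm).1 (hq hm).1, by rw [(hp hm).2, (hq hm).2]⟩
  | monomial n c =>
    rw [← C_mul_X_pow_eq_monomial]
    induction n generalizing m with
    | zero =>
      simp only [pow_zero, mul_one, aeval_C, AlgHom.commutes, Module.algebraMap_end_apply]
      exact ⟨(natDegree_smul_le _ _).trans hm, by rw [coeff_smul, smul_eq_C_mul]⟩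
    | succ n ih =>
      have h1 : (actX K m).natDegree ≤ e := by
        rw [actX_apply]
        refine natDegree_add_le_of_degree_le ((natDegree_C_mul_le _ _).trans hm) ?_
        exact (natDegree_derivative_le m).trans (by omega)
      have h2 : (actX K m).coeff e = X * m.coeff e := by
        rw [actX_apply, coeff_add, coeff_C_mul, coeff_derivative,
          coeff_eq_zero_of_natDegree_lt (by omega : m.natDegree < e + 1)]
        simp
      have := ih h1
      rw [pow_succ, ← mul_assoc, map_mul, aeval_X, map_mul, rep_x, Module.End.mul_apply]
      refine ⟨this.1, ?_⟩
      rw [this.2, h2]; ring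

theorem rep_y_pow (i : ℕ) (m : K[X][X]) : rep K (y K ^ i) m = X ^ i * m := by
  induction i with
  | zero => simp
  | succ i ih => rw [pow_succ', map_mul, Module.End.mul_apply, ih, rep_y, actY_apply]; ring

/-- The correction `d/dy` in the action of `x` lowers the `y`-degree, so at the top degree the
product is the commutative one. -/
theorem natDegree_rep_ofSymbol_le {q m : K[X][X]} {n e : ℕ} (hq : q.natDegree ≤ n)
    (hm : m.natDegree ≤ e) :
    (rep K (ofSymbol K q) m).natDegree ≤ n + e ∧
      (rep K (ofSymbol K q) m).coeff (n + e) = q.coeff n * m.coeff e := by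
  refine induction_with_natDegree_le (fun q => (rep K (ofSymbol K q) m).natDegree ≤ n + e ∧
    (rep K (ofSymbol K q) m).coeff (n + e) = q.coeff n * m.coeff e) n ?_ ?_ ?_ q hq
  · simp
  · intro i r hr hi
    obtain ⟨h1, h2⟩ := natDegree_rep_aeval_x_le r hm
    rw [C_mul_X_pow_eq_monomial, ofSymbol_monomial, map_mul, Module.End.mul_apply, rep_y_pow]
    refine ⟨natDegree_mul_le.trans (by rw [natDegree_X_pow]; omega), ?_⟩
    rw [coeff_monomial]
    split_ifs with h
    · subst h; rw [add_comm, coeff_X_pow_mul, h2]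
    · rw [coeff_X_pow_mul', if_pos (by omega), zero_mul, coeff_eq_zero_of_natDegree_lt]
      omega
  · intro p q _ _ hp hq
    simp only [map_add, LinearMap.add_apply, coeff_add, add_mul]
    exact ⟨natDegree_add_le_of_degree_le hp.1 hq.1, by rw [hp.2, hq.2]⟩

theorem rep_aeval_x_one (r : K[X]) : rep K (aeval (x K) r) 1 = C r := by
  obtain ⟨h1, h2⟩ := natDegree_rep_aeval_x_le r (e := 0) (m := 1) (by simp)
  rw [eq_C_of_natDegree_le_zero h1, h2]; simp

theorem rep_ofSymbol_one (q : K[X][X]) : rep K (ofSymbol K q) 1 = q := by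
  induction q using Polynomial.induction_on' with
  | add p q hp hq => simp only [map_add, LinearMap.add_apply, hp, hq]
  | monomial i r =>
    rw [ofSymbol_monomial, map_mul, Module.End.mul_apply, rep_aeval_x_one, rep_y_pow,
      ← C_mul_X_pow_eq_monomial, mul_comm]

variable (K) in
/-- The normal symbol: the Weyl algebra is `K[t][y]` as a vector space. -/
noncomputable def symbol : WeylAlgebra K ≃ₗ[K] K[X][X] :=
  LinearEquiv.symm
    { ofSymbol K with
      invFun := fun a => rep K a 1
      left_inv := rep_ofSymbol_one
      right_inv := fun a => by simp [ofSymbol_rep] }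

theorem symbol_apply (a : WeylAlgebra K) : symbol K a = rep K a 1 := rfl

theorem symbol_symm_apply (q : K[X][X]) : (symbol K).symm q = ofSymbol K q := rfl

theorem ofSymbol_symbol (a : WeylAlgebra K) : ofSymbol K (symbol K a) = a :=
  (symbol K).symm_apply_apply a

theorem symbol_mul (a b : WeylAlgebra K) : symbol K (a * b) = rep K a (symbol K b) := by
  simp [symbol_apply]

@[simp] theorem symbol_one : symbol K 1 = 1 := by simp [symbol_apply]

theorem coeff_symbol_mul (a b : WeylAlgebra K) :
    (symbol K (a * b)).natDegree ≤ (symbol K a).natDegree + (symbol K b).natDegree ∧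
    (symbol K (a * b)).coeff ((symbol K a).natDegree + (symbol K b).natDegree) =
      (symbol K a).leadingCoeff * (symbol K b).leadingCoeff := by
  have := natDegree_rep_ofSymbol_le (le_refl (symbol K a).natDegree)
    (le_refl (symbol K b).natDegree)
  rwa [ofSymbol_symbol, ← symbol_mul] at this

theorem natDegree_symbol_mul {a b : WeylAlgebra K} (ha : a ≠ 0) (hb : b ≠ 0) :
    (symbol K (a * b)).natDegree = (symbol K a).natDegree + (symbol K b).natDegree := by
  obtain ⟨h1, h2⟩ := coeff_symbol_mul a b
  refine h1.antisymm (le_natDegree_of_ne_zero ?_)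
  rw [h2]
  simp [ha, hb]

theorem leadingCoeff_symbol_mul {a b : WeylAlgebra K} (ha : a ≠ 0) (hb : b ≠ 0) :
    (symbol K (a * b)).leadingCoeff = (symbol K a).leadingCoeff * (symbol K b).leadingCoeff := by
  rw [← (coeff_symbol_mul a b).2, ← natDegree_symbol_mul ha hb, leadingCoeff]

instance : NoZeroDivisors (WeylAlgebra K) where
  eq_zero_or_eq_zero_of_mul_eq_zero {a b} h := by
    by_contra! hab
    have := leadingCoeff_symbol_mul hab.1 hab.2
    rw [h, map_zero, leadingCoeff_zero, eq_comm] at this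
    simp [hab.1, hab.2] at this

instance : Nontrivial (WeylAlgebra K) := (symbol K).toEquiv.nontrivial

/-! ### The twist on symbols -/

theorem ofSymbol_map_C_mul (s : K[X]) (m : K[X][X]) :
    ofSymbol K (s.map C * m) = aeval (y K) s * ofSymbol K m := by
  induction s using Polynomial.induction_on' with
  | add p q hp hq => simp only [Polynomial.map_add, map_add, add_mul, hp, hq]
  | monomial i c =>
    have h : ∀ i (m : K[X][X]), ofSymbol K (X ^ i * m) = y K ^ i * ofSymbol K m := by
      intro i m
      rw [← rep_y_pow, ofSymbol_rep]
    have h' : (C (C c) * (X ^ i * m) : K[X][X]) = c • (X ^ i * m) := by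
      rw [← smul_eq_C_mul, ← smul_one_smul K[X] c, smul_eq_C_mul c, mul_one]
    rw [map_monomial, ← C_mul_X_pow_eq_monomial, mul_assoc, h', map_smul, h, aeval_monomial,
      Algebra.smul_def, mul_assoc]

theorem twist_ofSymbol (p : ℕ) [CharP K p] (k : ℕ →₀ K) (q : K[X][X]) :
    twist p k (ofSymbol K q) = ofSymbol K (q.comp ((twistPoly p k).map C)) := by
  induction q using Polynomial.induction_on' with
  | add p q hp hq => simp only [map_add, add_comp, hp, hq]
  | monomial i r =>
    have h := ofSymbol_monomial (K := K) 0 r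
    rw [monomial_zero_left, pow_zero, one_mul] at h
    rw [ofSymbol_monomial, monomial_comp, mul_comm, ← Polynomial.map_pow, ofSymbol_map_C_mul, h,
      map_mul, map_pow, twist_y, map_pow, ← aeval_algHom_apply, twist_x]

/-- On symbols the twist substitutes a polynomial for `y`. Its derivative is `1`, so it is not
constant and the substitution kills nothing. -/
theorem twist_injective (p : ℕ) [CharP K p] (k : ℕ →₀ K) :
    Function.Injective (twist p k) := by
  rw [injective_iff_map_eq_zero]
  intro a ha
  rw [← ofSymbol_symbol a, twist_ofSymbol, ← symbol_symm_apply, LinearEquiv.map_eq_zero_iff,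
    comp_eq_zero_iff] at ha
  rcases ha with h | ⟨-, h⟩
  · simpa using h
  · have h1 := congrArg derivative h
    rw [derivative_map, derivative_twistPoly] at h1
    simp at h1

/-! ### Lexicographic degree -/

/-- The coefficient of `yⁱ xʲ` in normal order, for `e = (i, j)`. -/
noncomputable def coeff₂ (e : ℕ ×ₗ ℕ) : WeylAlgebra K →ₗ[K] K :=
  lcoeff K (ofLex e).2 ∘ₗ (lcoeff K[X] (ofLex e).1).restrictScalars K ∘ₗ (symbol K).toLinearMap

theorem coeff₂_apply (e : ℕ ×ₗ ℕ) (a : WeylAlgebra K) :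
    coeff₂ e a = ((symbol K a).coeff (ofLex e).1).coeff (ofLex e).2 := rfl

/-- The lexicographic degree, in `y` first and then in `x`. -/
noncomputable def ldeg (a : WeylAlgebra K) : ℕ ×ₗ ℕ :=
  toLex ((symbol K a).natDegree, (symbol K a).leadingCoeff.natDegree)

theorem coeff₂_ldeg_ne_zero {a : WeylAlgebra K} (ha : a ≠ 0) : coeff₂ (ldeg a) a ≠ 0 := by
  change (symbol K a).leadingCoeff.leadingCoeff ≠ 0
  simpa using ha

theorem coeff₂_eq_zero_of_ldeg_lt {a : WeylAlgebra K} {e : ℕ ×ₗ ℕ} (h : ldeg a < e) :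
    coeff₂ e a = 0 := by
  rw [coeff₂_apply]
  rcases Prod.Lex.lt_iff.1 h with h | ⟨h, h'⟩
  · rw [coeff_eq_zero_of_natDegree_lt h, coeff_zero]
  · rw [← h]
    exact coeff_eq_zero_of_natDegree_lt h'

theorem ldeg_mul {a b : WeylAlgebra K} (ha : a ≠ 0) (hb : b ≠ 0) :
    ldeg (a * b) = ldeg a + ldeg b := by
  rw [ldeg, natDegree_symbol_mul ha hb, leadingCoeff_symbol_mul ha hb, natDegree_mul]
  · rfl
  · simpa using ha
  · simpa using hb

@[simp] theorem ldeg_zero : ldeg (0 : WeylAlgebra K) = 0 := by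
  simp [ldeg]

@[simp] theorem ldeg_one : ldeg (1 : WeylAlgebra K) = 0 := by
  simp [ldeg]

theorem ldeg_pow {a : WeylAlgebra K} (ha : a ≠ 0) (n : ℕ) : ldeg (a ^ n) = n • ldeg a := by
  induction n with
  | zero => simp
  | succ n ih => rw [pow_succ, ldeg_mul (pow_ne_zero _ ha) ha, ih, succ_nsmul]

theorem ldeg_sub_le (a b : WeylAlgebra K) : ldeg (a - b) ≤ max (ldeg a) (ldeg b) := by
  by_cases h : a - b = 0
  · rw [h, ldeg_zero, le_max_iff]
    left
    rw [Prod.Lex.le_iff]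
    by_cases h0 : (ofLex (ldeg a)).1 = 0
    · right; exact ⟨h0.symm, Nat.zero_le _⟩
    · left; exact Nat.pos_of_ne_zero h0
  · have := coeff₂_ldeg_ne_zero h
    rw [le_max_iff]
    by_contra! hlt
    rw [map_sub, coeff₂_eq_zero_of_ldeg_lt hlt.1, coeff₂_eq_zero_of_ldeg_lt hlt.2] at this
    simp at this

theorem exists_ldeg_sub_smul_lt {a b : WeylAlgebra K} (hb : b ≠ 0)
    (h : ldeg a = ldeg b) : ∃ c : K, a - c • b = 0 ∨ ldeg (a - c • b) < ldeg a := by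
  have hb' := coeff₂_ldeg_ne_zero hb
  refine ⟨coeff₂ (ldeg b) a / coeff₂ (ldeg b) b, or_iff_not_imp_left.2 fun hne => ?_⟩
  set c := coeff₂ (ldeg b) a / coeff₂ (ldeg b) b
  have h1 := coeff₂_ldeg_ne_zero hne
  have h2 : coeff₂ (ldeg b) (a - c • b) = 0 := by
    rw [map_sub, map_smul, smul_eq_mul, div_mul_cancel₀ _ hb', sub_self]
  refine lt_of_le_of_ne (not_lt.1 fun hlt => h1 ?_) ?_
  · rw [map_sub, map_smul, coeff₂_eq_zero_of_ldeg_lt hlt, coeff₂_eq_zero_of_ldeg_lt (h ▸ hlt)]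
    simp
  · intro heq
    rw [heq, h] at h1
    exact h1 h2

/-- In a vanishing combination the term of largest degree has nothing to cancel against. -/
theorem linearIndependent_of_ldeg_injective {ι : Type*} (g : ι → WeylAlgebra K)
    (hg : ∀ i, g i ≠ 0) (hinj : Function.Injective fun i => ldeg (g i)) :
    LinearIndependent K g := by
  rw [linearIndependent_iff']
  intro s c hc
  by_contra! hne
  obtain ⟨i₀, hi₀, hci₀⟩ := hne
  classical
  obtain ⟨i, hi, hmax⟩ := (s.filter fun i => c i ≠ 0).exists_max_image (fun i => ldeg (g i))
    ⟨i₀, by simp [hi₀, hci₀]⟩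
  rw [Finset.mem_filter] at hi
  have h := congrArg (coeff₂ (ldeg (g i))) hc
  rw [map_sum, map_zero, Finset.sum_eq_single i] at h
  · rw [map_smul, smul_eq_mul] at h
    exact mul_ne_zero hi.2 (coeff₂_ldeg_ne_zero (hg i)) h
  · intro j hj hji
    rw [map_smul, smul_eq_mul]
    by_cases hcj : c j = 0
    · rw [hcj, zero_mul]
    · rw [coeff₂_eq_zero_of_ldeg_lt, mul_zero]
      exact lt_of_le_of_ne (hmax j (by simp [hj, hcj])) fun h => hji (hinj h)
  · exact fun h => absurd hi.1 h

/-! ### Boxes of monomials and growth of images -/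

variable (K) in
/-- The span of the monomials of degree less than `n` in both variables. -/
noncomputable def box (n : ℕ) : Submodule K K[X][X] where
  carrier := {q | ∀ i j, n ≤ i ∨ n ≤ j → (q.coeff i).coeff j = 0}
  zero_mem' := by simp
  add_mem' := by
    intro a b ha hb i j h
    rw [coeff_add, coeff_add, ha i j h, hb i j h, add_zero]
  smul_mem' := by
    intro c a ha i j h
    rw [coeff_smul, coeff_smul, ha i j h, smul_zero]

theorem box_mono {m n : ℕ} (h : m ≤ n) : box K m ≤ box K n :=
  fun _ ha i j hij => ha i j (by omega)

theorem one_mem_box : (1 : K[X][X]) ∈ box K 1 := by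
  intro i j h
  rw [coeff_one]
  split_ifs with hi
  · rw [coeff_one, if_neg (by omega)]
  · rw [coeff_zero]

/-- Each letter enlarges a box by at most one, so a fixed element enlarges every box by a bounded
amount. -/
theorem exists_rep_mem_box (a : WeylAlgebra K) :
    ∃ d, ∀ n, ∀ q ∈ box K n, rep K a q ∈ box K (n + d) := by
  induction a using induction_on with
  | hx =>
    refine ⟨1, fun n b hb i j h => ?_⟩
    rw [rep_x, actX_apply, coeff_add, coeff_C_mul, coeff_derivative, coeff_add,
      show ((i : K[X]) + 1) = C (i + 1 : K) by simp, coeff_mul_C, hb (i + 1) j (by omega),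
      zero_mul, add_zero]
    cases j with
    | zero => simp
    | succ j => rw [coeff_X_mul, hb i j (by omega)]
  | hy =>
    refine ⟨1, fun n b hb i j h => ?_⟩
    rw [rep_y, actY_apply]
    cases i with
    | zero => simp
    | succ i => rw [coeff_X_mul, hb i j (by omega)]
  | hC c =>
    refine ⟨0, fun n b hb => ?_⟩
    rw [AlgHom.commutes, Module.algebraMap_end_apply]
    exact Submodule.smul_mem _ _ hb
  | hadd a b ha hb =>
    obtain ⟨d, hd⟩ := ha
    obtain ⟨e, he⟩ := hb
    refine ⟨d + e, fun n c hc => ?_⟩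
    rw [map_add]
    exact add_mem (box_mono (by omega) (hd n c hc)) (box_mono (by omega) (he n c hc))
  | hmul a b ha hb =>
    obtain ⟨d, hd⟩ := ha
    obtain ⟨e, he⟩ := hb
    refine ⟨e + d, fun n c hc => ?_⟩
    rw [map_mul, Module.End.mul_apply, ← add_assoc]
    exact hd _ _ (he n c hc)

variable (K) in
/-- The box of size `n` is `n²`-dimensional. -/
noncomputable def boxEquiv (n : ℕ) : box K n ≃ₗ[K] (Fin n × Fin n → K) :=
  LinearEquiv.ofBijective
    { toFun := fun q s => (q.1.coeff s.1).coeff s.2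
      map_add' := fun a b => by ext s; simp
      map_smul' := fun c a => by ext s; simp }
    (by
      constructor
      · refine (injective_iff_map_eq_zero _).2 ?_
        rintro ⟨q, hq⟩ h
        refine Subtype.ext (Polynomial.ext fun i => Polynomial.ext fun j => ?_)
        by_cases hij : n ≤ i ∨ n ≤ j
        · simpa using hq i j hij
        · simpa using congrFun h (⟨i, by omega⟩, ⟨j, by omega⟩)
      · intro c
        set q : K[X][X] := ∑ s : Fin n × Fin n, monomial s.1 (monomial s.2 (c s))
        have hq : ∀ i j, (q.coeff i).coeff j =
            ∑ s : Fin n × Fin n, if (s.1 : ℕ) = i ∧ (s.2 : ℕ) = j then c s else 0 := by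
          intro i j
          simp only [q, finsetSum_coeff, coeff_monomial]
          refine Finset.sum_congr rfl fun s _ => ?_
          by_cases h1 : (s.1 : ℕ) = i <;> simp [h1, coeff_monomial]
        refine ⟨⟨q, fun i j h => ?_⟩, ?_⟩
        · rw [hq]
          refine Finset.sum_eq_zero fun s _ => if_neg ?_
          have := s.1.2
          have := s.2.2
          omega
        · ext s
          simp only [LinearMap.coe_mk, AddHom.coe_mk, hq]
          rw [Finset.sum_eq_single s]
          · simp
          · intro t _ hts
            exact if_neg fun h => hts (Prod.ext (Fin.ext h.1) (Fin.ext h.2))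
          · simp)

instance (n : ℕ) : FiniteDimensional K (box K n) := (boxEquiv K n).symm.finiteDimensional

theorem finrank_box (n : ℕ) : Module.finrank K (box K n) = n * n := by
  rw [(boxEquiv K n).finrank_eq]; simp

/-- An endomorphism of the Weyl algebra in terms of symbols. -/
noncomputable def onSymbols (F : WeylAlgebra K →ₐ[K] WeylAlgebra K) : K[X][X] →ₗ[K] K[X][X] :=
  (symbol K).toLinearMap ∘ₗ F.toLinearMap ∘ₗ (symbol K).symm.toLinearMap

theorem onSymbols_symbol (F : WeylAlgebra K →ₐ[K] WeylAlgebra K) (a : WeylAlgebra K) :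
    onSymbols F (symbol K a) = symbol K (F a) := by
  simp [onSymbols]

/-- A non-injective endomorphism has an image of linear growth. -/
theorem finrank_map_box_le (F : WeylAlgebra K →ₐ[K] WeylAlgebra K) {w : WeylAlgebra K}
    (hw : w ≠ 0) (hFw : F w = 0) : ∃ d, ∀ n,
      Module.finrank K ((box K (n + d)).map (onSymbols F)) + n * n ≤ (n + d) * (n + d) := by
  obtain ⟨d, hd⟩ := exists_rep_mem_box w
  refine ⟨d, fun n => ?_⟩
  have hinj : Function.Injective (rep K w) := by
    refine (injective_iff_map_eq_zero _).2 fun q hq => ?_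
    obtain ⟨c, rfl⟩ := (symbol K).surjective q
    rw [← symbol_mul, LinearEquiv.map_eq_zero_iff, mul_eq_zero, or_iff_right hw] at hq
    rw [hq, map_zero]
  -- The multiples of `w` by the box of size `n` form an `n²`-dimensional part of the kernel inside
  -- the box of size `n + d`.
  have h := finrank_map_add_finrank_le (onSymbols F) (S := box K (n + d))
    (T := (box K n).map (rep K w)) (Submodule.map_le_iff_le_comap.2 (hd n)) <| by
      rintro _ ⟨q, -, rfl⟩
      obtain ⟨c, rfl⟩ := (symbol K).surjective q
      rw [LinearMap.mem_ker, ← symbol_mul, onSymbols_symbol, map_mul, hFw, zero_mul, map_zero]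
  rwa [finrank_box, ← (Submodule.equivMapOfInjective _ hinj (box K n)).finrank_eq,
    finrank_box] at h

theorem rep_pow_mem_box {a : WeylAlgebra K} {d : ℕ}
    (hd : ∀ n, ∀ q ∈ box K n, rep K a q ∈ box K (n + d)) (i n : ℕ) {q : K[X][X]}
    (hq : q ∈ box K n) : rep K (a ^ i) q ∈ box K (n + i * d) := by
  induction i with
  | zero => simpa using hq
  | succ i ih =>
    rw [pow_succ', map_mul, Module.End.mul_apply, add_mul, one_mul, ← add_assoc]
    exact hd _ _ ih

/-- The lexicographic degrees in the image of a non-injective endomorphism are parallel. -/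
theorem ldeg_parallel (F : WeylAlgebra K →ₐ[K] WeylAlgebra K) {w : WeylAlgebra K}
    (hw : w ≠ 0) (hFw : F w = 0) (a b : WeylAlgebra K) :
    (ofLex (ldeg (F a))).1 * (ofLex (ldeg (F b))).2 =
      (ofLex (ldeg (F b))).1 * (ofLex (ldeg (F a))).2 := by
  by_contra hne
  have ha : F a ≠ 0 := by
    intro h; apply hne; rw [h, ldeg_zero]; simp
  have hb : F b ≠ 0 := by
    intro h; apply hne; rw [h, ldeg_zero]; simp
  obtain ⟨d, hd⟩ := finrank_map_box_le F hw hFw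
  obtain ⟨s, hs⟩ := exists_rep_mem_box a
  obtain ⟨t, ht⟩ := exists_rep_mem_box b
  -- The `N²` products `F a ^ i * F b ^ j` have distinct degrees, because the two degree vectors
  -- have nonzero determinant. They come from a box whose size is linear in `N`.
  have key : ∀ N : ℕ, N * N ≤
      Module.finrank K ((box K (1 + N * t + N * s + d)).map (onSymbols F)) := by
    intro N
    set V := (box K (1 + N * t + N * s + d)).map (onSymbols F)
    let g : Fin N × Fin N → WeylAlgebra K := fun r => F a ^ (r.1 : ℕ) * F b ^ (r.2 : ℕ)
    have hg : LinearIndependent K g := by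
      refine linearIndependent_of_ldeg_injective g
        (fun r => mul_ne_zero (pow_ne_zero _ ha) (pow_ne_zero _ hb)) ?_
      rintro ⟨i, j⟩ ⟨i', j'⟩ h
      simp only [g, ldeg_mul (pow_ne_zero _ ha) (pow_ne_zero _ hb), ldeg_pow ha,
        ldeg_pow hb] at h
      generalize ldeg (F a) = A at *
      generalize ldeg (F b) = B at *
      have h1 : (i : ℤ) * (ofLex A).1 + j * (ofLex B).1 = i' * (ofLex A).1 + j' * (ofLex B).1 := by
        exact_mod_cast congrArg (fun e => (ofLex e).1) h
      have h2 : (i : ℤ) * (ofLex A).2 + j * (ofLex B).2 = i' * (ofLex A).2 + j' * (ofLex B).2 := by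
        exact_mod_cast congrArg (fun e => (ofLex e).2) h
      have hne' : ((ofLex A).1 * (ofLex B).2 - (ofLex B).1 * (ofLex A).2 : ℤ) ≠ 0 := by
        rw [sub_ne_zero]; exact_mod_cast hne
      have e1 : (i : ℤ) = i' := by
        refine mul_right_cancel₀ hne' ?_
        linear_combination (ofLex B).2 * h1 - (ofLex B).1 * h2
      have e2 : (j : ℤ) = j' := by
        refine mul_right_cancel₀ hne' ?_
        linear_combination (ofLex A).1 * h2 - (ofLex A).2 * h1
      exact Prod.ext (Fin.ext (by exact_mod_cast e1)) (Fin.ext (by exact_mod_cast e2))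
    have hgV : ∀ r, symbol K (g r) ∈ V := by
      intro r
      refine ⟨symbol K (a ^ (r.1 : ℕ) * b ^ (r.2 : ℕ)), ?_, by simp [g, onSymbols_symbol]⟩
      rw [symbol_mul, symbol_apply]
      refine box_mono ?_ (rep_pow_mem_box hs r.1 _ (rep_pow_mem_box ht r.2 1 one_mem_box))
      have := Nat.mul_le_mul_right t r.2.2.le
      have := Nat.mul_le_mul_right s r.1.2.le
      omega
    have hg' : LinearIndependent K (fun r => (⟨symbol K (g r), hgV r⟩ : V)) :=
      LinearIndependent.of_comp V.subtype (hg.map' (symbol K).toLinearMap (symbol K).ker)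
    simpa using hg'.fintype_card_le_finrank
  -- Large enough that `N²` exceeds the linear bound `2d(1 + Nt + Ns) + d²`.
  set N := 2 * d * (t + s) + 2 * d + d * d + 1 with hN
  have h1 := key N
  have h2 := hd (1 + N * t + N * s)
  have h3 : N * N ≤ 2 * d * (1 + N * t + N * s) + d * d := by nlinarith
  have h4 : 2 * d * (1 + N * t + N * s) + d * d + N ≤ N * N := by
    have : N * N = N * (2 * d * (t + s)) + N * (2 * d + d * d) + N := by
      conv_lhs => rw [hN]
      rw [← hN]
      nlinarith
    have : 2 * d + d * d ≤ N * (2 * d + d * d) := Nat.le_mul_of_pos_left _ (by omega)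
    nlinarith
  omega

/-! ### Central `p`-th powers and injectivity -/

/-- The commutator of `xⁿ` with `y` is `n xⁿ⁻¹`, which vanishes for `n = p`. -/
theorem commute_x_pow {p : ℕ} [CharP K p] (a : WeylAlgebra K) : Commute (x K ^ p) a := by
  have hxy : x K * y K = y K * x K + 1 := by rw [← x_mul_y_sub K]; abel
  have h : ∀ n : ℕ, x K ^ n * y K = y K * x K ^ n + n * x K ^ (n - 1) := by
    intro n
    induction n with
    | zero => simp
    | succ n ih =>
      rw [pow_succ, mul_assoc, hxy, mul_add, ← mul_assoc, ih, add_mul]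
      cases n with
      | zero => simp
      | succ n =>
        simp only [Nat.add_sub_cancel]
        push_cast
        simp only [pow_succ]
        noncomm_ring
  induction a using induction_on with
  | hx => exact Commute.pow_self _ _
  | hy =>
    have hp : ((p : ℕ) : WeylAlgebra K) = 0 := by
      rw [← map_natCast (algebraMap K _), CharP.cast_eq_zero, map_zero]
    have := h p
    rwa [hp, zero_mul, add_zero] at this
  | hC c => exact (Algebra.commutes c _).symm
  | hadd a b ha hb => exact ha.add_right hb
  | hmul a b ha hb => exact ha.mul_right hb

theorem commute_y_pow {p : ℕ} [CharP K p] (a : WeylAlgebra K) : Commute (y K ^ p) a := by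
  induction a using induction_on with
  | hx =>
    have := x_mul_aeval (K := K) (X ^ p)
    simp only [map_pow, aeval_X, derivative_X_pow, CharP.cast_eq_zero, map_zero, zero_mul,
      add_zero] at this
    exact this.symm
  | hy => exact Commute.pow_self _ _
  | hC c => exact (Algebra.commutes c _).symm
  | hadd a b ha hb => exact ha.add_right hb
  | hmul a b ha hb => exact ha.mul_right hb

theorem algHom_injective (p : ℕ) [Fact p.Prime] [CharP K p]
    (F : WeylAlgebra K →ₐ[K] WeylAlgebra K) : Function.Injective F := by
  rw [injective_iff_map_eq_zero]
  intro w hFw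
  by_contra hw
  have hpar := ldeg_parallel F hw hFw
  let v : F.range → ℕ := fun a => (ofLex (ldeg a.1)).1 + (ofLex (ldeg a.1)).2
  have hpar' : ∀ a b : F.range, (ofLex (ldeg a.1)).1 * (ofLex (ldeg b.1)).2 =
      (ofLex (ldeg b.1)).1 * (ofLex (ldeg a.1)).2 := by
    rintro ⟨_, a, rfl⟩ ⟨_, b, rfl⟩
    exact hpar a b
  -- On a single ray the lexicographic order and the order by total degree agree.
  have hlt : ∀ a b : F.range, ldeg a.1 < ldeg b.1 → v a < v b := by
    intro a b h
    have h1 := hpar' a b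
    have h2 := Prod.Lex.lt_iff.1 h
    simp only [v]
    generalize ofLex (ldeg a.1) = A at *
    generalize ofLex (ldeg b.1) = B at *
    rcases h2 with h2 | ⟨h2, h3⟩
    · by_contra! h4
      have h5 : B.2 < A.2 := by omega
      nlinarith [Nat.mul_le_mul_left B.1 h5, Nat.mul_le_mul_right B.2 h2]
    · omega
  have hle : ∀ a b : F.range, ldeg a.1 ≤ ldeg b.1 → v a ≤ v b := by
    intro a b h
    rcases h.lt_or_eq with h | h
    · exact (hlt a b h).le
    · simp only [v, h, le_refl]
  have hv : ∀ a b : F.range, v a = v b → ldeg a.1 = ldeg b.1 := by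
    intro a b h
    rcases lt_trichotomy (ldeg a.1) (ldeg b.1) with h' | h' | h'
    · exact absurd h (hlt _ _ h').ne
    · exact h'
    · exact absurd h (hlt _ _ h').ne'
  have hmul : ∀ a b : F.range, a ≠ 0 → b ≠ 0 → v (a * b) = v a + v b := by
    intro a b ha hb
    have h : ldeg (a * b).1 = ldeg a.1 + ldeg b.1 :=
      ldeg_mul (by simpa using ha) (by simpa using hb)
    simp only [v, h, ofLex_add, Prod.fst_add, Prod.snd_add]
    ring
  have hleaf : ∀ a b : F.range, a ≠ 0 → b ≠ 0 → v a = v b →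
      ∃ c : K, a - c • b = 0 ∨ v (a - c • b) < v a := by
    intro a b _ hb h
    obtain ⟨c, hc | hc⟩ := exists_ldeg_sub_smul_lt (by simpa using hb) (hv a b h)
    · exact ⟨c, Or.inl (Subtype.ext hc)⟩
    · exact ⟨c, Or.inr (hlt _ _ hc)⟩
  have hone : v 1 = 0 := by simp [v]
  have hcomm : ∀ z : F.range, (∀ b, Commute z b) → v z = 0 := by
    intro z hz
    by_contra hvz
    have := mul_comm_of_degree_leaf v (by simp [v]) hmul
      (fun a b => by
        rcases le_max_iff.1 (ldeg_sub_le a.1 b.1) with h | h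
        · exact le_max_of_le_left (hle _ _ h)
        · exact le_max_of_le_right (hle _ _ h))
      hleaf z hz (Nat.pos_of_ne_zero hvz)
      ⟨F (x K), x K, rfl⟩ ⟨F (y K), y K, rfl⟩
    have h1 : F (x K) * F (y K) = F (y K) * F (x K) := congrArg Subtype.val this
    have h2 := congrArg F (x_mul_y_sub K)
    rw [map_sub, map_mul, map_mul, h1, sub_self, map_one] at h2
    exact zero_ne_one h2
  -- Since `F a ^ p` is central in the image it has degree zero, hence so has `F a`; the leaf of
  -- degree zero is that of `1`.
  have hscalar : ∀ a : WeylAlgebra K, (∀ b, Commute (a ^ p) b) → ∃ c : K, F a = c • 1 := by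
    intro a ha
    by_cases h0 : F a = 0
    · exact ⟨0, by simp [h0]⟩
    let a' : F.range := ⟨F a, a, rfl⟩
    have ha' : a' ≠ 0 := fun h => h0 (congrArg Subtype.val h)
    have hva : v (a' ^ p) = 0 := by
      apply hcomm
      rintro ⟨_, b, rfl⟩
      refine Subtype.ext ?_
      change F a ^ p * F b = F b * F a ^ p
      rw [← map_pow, ← map_mul, (ha b).eq, map_mul]
    have hp := (Fact.out : p.Prime).ne_zero
    have hva' : v a' = 0 := by
      obtain ⟨n, rfl⟩ := Nat.exists_eq_succ_of_ne_zero hp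
      rw [pow_succ, hmul _ _ (pow_ne_zero _ ha') ha'] at hva
      omega
    obtain ⟨c, hc | hc⟩ := hleaf a' 1 ha' one_ne_zero (hva'.trans hone.symm)
    · exact ⟨c, sub_eq_zero.1 (congrArg Subtype.val hc)⟩
    · omega
  obtain ⟨c, hc⟩ := hscalar (x K) commute_x_pow
  obtain ⟨e, he⟩ := hscalar (y K) commute_y_pow
  have h2 := congrArg F (x_mul_y_sub K)
  rw [map_sub, map_mul, map_mul, hc, he, map_one] at h2
  rw [smul_mul_smul_comm, smul_mul_smul_comm, mul_comm e c, sub_self] at h2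
  exact zero_ne_one h2

end WeylAlgebra

/-! ### Reduction to algebra endomorphisms -/

theorem mainTheorem6 {K : Type*} [Field K] (p : ℕ) [Fact p.Prime] [CharP K p] (k : ℕ →₀ K)
    (f : (homWeylAlgebra p k).End) (hf : f.toLinearMap ≠ 0) :
    Function.Injective f.toLinearMap := by
  have hmul : ∀ a b, f.toLinearMap (a * b) = f.toLinearMap a * f.toLinearMap b := by
    intro a b
    apply WeylAlgebra.twist_injective p k
    have h1 : f.toLinearMap (WeylAlgebra.twist p k (a * b)) =
        WeylAlgebra.twist p k (f.toLinearMap a * f.toLinearMap b) := f.map_mul a b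
    have h2 : f.toLinearMap (WeylAlgebra.twist p k (a * b)) =
        WeylAlgebra.twist p k (f.toLinearMap (a * b)) := LinearMap.congr_fun f.map_twist (a * b)
    rw [← h1, h2]
  have hone : f.toLinearMap 1 = 1 := by
    -- The image of `1` is idempotent in a domain, and it is not `0` because `f` is nonzero.
    have h : f.toLinearMap 1 * (f.toLinearMap 1 - 1) = 0 := by
      rw [mul_sub, ← hmul, mul_one, mul_one, sub_self]
    rcases mul_eq_zero.1 h with h | h
    · refine absurd (LinearMap.ext fun a => ?_) hf
      rw [← mul_one a, hmul, h, mul_zero, LinearMap.zero_apply]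
    · exact sub_eq_zero.1 h
  exact WeylAlgebra.algHom_injective p (AlgHom.ofLinearMap f.toLinearMap hone hmul)
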